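/- Let $g$ be a real function that is analytic on a neighbourhood of $[a,b]$, where $a<0<b$, with $g(0)=0$ and $g'(0)=1$, and let $G(x)=\int_0^x g(\xi)\,d\xi$ be its potential. Assume that $G(a)=G(b)=c$, and that $G(x)<c$ for all $a<x<b$ and $x\,g(x)>0$ for all $a<x<b$ with $x\neq 0$. Then the origin is an isochronous center of $\ddot x+g(x)=0$ (that is, of the system $\dot x=y$, $\dot y=-g(x)$: all orbits through points of some punctured neighbourhood of the origin are periodic, with one and the same minimal period) if and only if there is a function $f$, analytic in a neighbourhood of $0$, such that $$\frac{d}{dx}\left[\frac{G(x)}{g(x)^2}\right]=f(G(x))\qquad\text{for all } x\neq 0 \text{ near } 0.\qquad (*)$$ Moreover, the Taylor coefficients of such an $f$ at $0$ are determined by those of $g$: for every $n\ge 0$, $f^{(n)}(0)$ depends only on the derivatives of $g$ at $0$ of order at most $2n+2$ (if $g_1$ satisfies the same assumptions, possibly with other $a,b,c$, if $f_1$ is analytic near $0$ and satisfies $(*)$ for $g_1$, and if $g_1^{(k)}(0)=g^{(k)}(0)$ for all $k\le 2n+2$, then $f_1^{(n)}(0)=f^{(n)}(0)$). In particular $$f(0)=-\frac{g''(0)}{3},\qquad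 f'(0)=\frac79\,g''(0)^3-\frac15\,g^{(4)}(0),$$ $$f''(0)=-\frac1{21}\,g^{(6)}(0)-\frac{310}{54}\,g''(0)^5+2\,g''(0)^2g^{(4)}(0).$$ -/

import Mathlib

open Set Filter Topology

/-- The potential `G(x) = ∫₀ˣ g(ξ) dξ` of the equation `x'' + g(x) = 0`. -/
noncomputable def potential (g : ℝ → ℝ) (x : ℝ) : ℝ := ∫ ξ in (0 : ℝ)..x, g ξ

/-- The standing hypothesis on `g`, with its interval `[a, b]` and its energy `c`, together with
analyticity of `g` on (a neighbourhood of) `[a, b]` and the normalization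
`g(0) = 0`, `g'(0) = 1`. -/
structure StandingHypothesis (g : ℝ → ℝ) (a b c : ℝ) : Prop where
  analytic : AnalyticOnNhd ℝ g (Icc a b)
  left_neg : a < 0
  right_pos : 0 < b
  potential_left : potential g a = c
  potential_right : potential g b = c
  potential_lt : ∀ x, a < x → x < b → potential g x < c
  sign : ∀ x, a < x → x < b → x ≠ 0 → 0 < x * g x
  map_zero : g 0 = 0
  deriv_zero : deriv g 0 = 1

/-- `γ = (x, y)` is a solution, defined for all times, of the planar system
`x' = y`, `y' = -g(x)`, which is equivalent to `x'' + g(x) = 0`. -/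
def IsSolution (g : ℝ → ℝ) (γ : ℝ → ℝ × ℝ) : Prop :=
  ∀ t, HasDerivAt (fun s => (γ s).1) (γ t).2 t ∧ HasDerivAt (fun s => (γ s).2) (-g (γ t).1) t

/-- `T` is the minimal (positive) period of `γ`; in particular `γ` is periodic. -/
def HasMinimalPeriod (γ : ℝ → ℝ × ℝ) (T : ℝ) : Prop :=
  0 < T ∧ Function.Periodic γ T ∧ ∀ S, 0 < S → Function.Periodic γ S → T ≤ S

/-- The origin is a center of the planar system: it is an equilibrium, and it has a punctured
neighbourhood through every point of which there passes a solution, every such solution being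
periodic with a minimal period (hence not constant). -/
def HasCenter (g : ℝ → ℝ) : Prop :=
  g 0 = 0 ∧ ∀ᶠ p in 𝓝[≠] (0 : ℝ × ℝ),
    (∃ γ, IsSolution g γ ∧ γ 0 = p) ∧
    ∀ γ, IsSolution g γ → γ 0 = p → ∃ T, HasMinimalPeriod γ T

/-- The origin is an isochronous center: a center such that all orbits near it have the same
minimal period. -/
def HasIsochronousCenter (g : ℝ → ℝ) : Prop :=
  HasCenter g ∧ ∃ T, ∀ᶠ p in 𝓝[≠] (0 : ℝ × ℝ),
    ∀ γ, IsSolution g γ → γ 0 = p → HasMinimalPeriod γ T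

/-- `f` is analytic near `0` and `d/dx [G(x) / g(x)²] = f(G(x))` near `x = 0`. The point `x = 0`,
where the quotient reads `0 / 0`, is left out. -/
def QuotientRelation (g f : ℝ → ℝ) : Prop :=
  AnalyticAt ℝ f 0 ∧ ∀ᶠ x in 𝓝[≠] (0 : ℝ),
    HasDerivAt (fun s => potential g s / g s ^ 2) (f (potential g x)) x

/-! The argument rests on the energy coordinate `u = ± √(2 G x)` near the origin, with inverse
`x = X u`, where `G` is the potential. It is analytic, `X' 0 = 1`, and differentiating
`2 G (X u) = u ^ 2` gives `g (X u) X' u = u`.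

In the polar coordinates `u = r sin θ`, `y = r cos θ` the orbits are the circles `r = const`, run
through with angular speed `1 / X' (r sin θ)` (`exists_periodic_orbit`). Hence every orbit near the
origin is periodic, of minimal period `∫₀²ᵖⁱ X' (r sin s) ds`, and solutions are unique
(`IsSolution.eq_of_analyticAt`), so that the origin is isochronous iff this integral does not depend
on `r`. Only the even part of `X'` enters the integral. If the even part is constant, so is the
integral; conversely, an analytic even part which is not constant differs from its value at `0` with
one strict sign on a punctured neighbourhood of `0`, and the integral varies
(`AnalyticAt.eventually_eq_of_even_of_integral_eq`). Isochronicity thus means that `X''` is even.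

On the other side `G / g ^ 2 = X' ^ 2 / 2`, whose derivative with respect to `x` is `X''`
(`IsEnergyChart.hasDerivAt_quotient`). So the relation `d/dx [G / g ^ 2] = f (G)` reads
`X'' u = f (u ^ 2 / 2)`, and an analytic `f` of this kind exists iff `X''` is even
(`IsEnergyChart.exists_quotientRelation_iff`).

The statements on the derivatives of `f` use the relation cleared of denominators,
`g ^ 2 - 2 G g' = g ^ 3 f (G)`. Comparing Taylor coefficients up to `x ^ 7` gives the three formulas
(`QuotientRelation.initial_derivatives`), and comparing the relation for two functions `g` with the
same jet gives the dependence on that jet only (`QuotientRelation.iteratedDeriv_eq`). -/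

open Asymptotics

/-! ### Power series and primitives of analytic functions -/

theorem AnalyticAt.hasDerivAt_potential {g : ℝ → ℝ} (hg : AnalyticAt ℝ g 0) :
    ∀ᶠ x in 𝓝 (0 : ℝ), HasDerivAt (potential g) (g x) x := by
  obtain ⟨ε, hε, hball⟩ := Metric.eventually_nhds_iff_ball.mp hg.eventually_analyticAt
  filter_upwards [Metric.ball_mem_nhds 0 hε] with x hx
  have hcont : ContinuousOn g (Metric.ball 0 ε) := fun y hy =>
    (hball y hy).continuousAt.continuousWithinAt
  have hsub : uIcc 0 x ⊆ Metric.ball 0 ε :=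
    (convex_ball (0 : ℝ) ε).ordConnected.uIcc_subset (Metric.mem_ball_self hε) hx
  exact intervalIntegral.integral_hasDerivAt_right (hcont.mono hsub).intervalIntegrable
    (hcont.stronglyMeasurableAtFilter Metric.isOpen_ball x hx) (hball x hx).continuousAt

theorem potential_zero (g : ℝ → ℝ) : potential g 0 = 0 := by simp [potential]

theorem AnalyticAt.deriv_potential {g : ℝ → ℝ} (hg : AnalyticAt ℝ g 0) :
    deriv (potential g) =ᶠ[𝓝 0] g :=
  hg.hasDerivAt_potential.mono fun _ h => h.deriv

theorem AnalyticAt.exists_norm_taylorCoeff_le {g : ℝ → ℝ} (hg : AnalyticAt ℝ g 0) :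
    ∃ C R : ℝ, 0 < R ∧ ∀ n, |iteratedDeriv n g 0 / n.factorial| ≤ C * R ^ n := by
  have hp := hg.hasFPowerSeriesAt
  obtain ⟨r, hr0, hr⟩ := ENNReal.lt_iff_exists_nnreal_btwn.mp hp.radius_pos
  obtain ⟨C, -, hC⟩ := FormalMultilinearSeries.norm_mul_pow_le_of_lt_radius _ hr
  have hr0' : (0 : ℝ) < r := by exact_mod_cast hr0
  refine ⟨C, (r : ℝ)⁻¹, inv_pos.mpr hr0', fun n => ?_⟩
  have := hC n
  rw [FormalMultilinearSeries.ofScalars_norm, Real.norm_eq_abs] at this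
  rw [inv_pow, ← div_eq_mul_inv, le_div_iff₀ (pow_pos hr0' n)]
  exact this

theorem exists_hasFPowerSeriesAt_ofScalars {c : ℕ → ℝ} {C R : ℝ} (hR : 0 < R)
    (hc : ∀ n, |c n| ≤ C * R ^ n) :
    ∃ F : ℝ → ℝ, HasFPowerSeriesAt F (FormalMultilinearSeries.ofScalars ℝ c) 0 := by
  refine ⟨_, (FormalMultilinearSeries.hasFPowerSeriesOnBall _ ?_).hasFPowerSeriesAt⟩
  refine lt_of_lt_of_le ?_ (FormalMultilinearSeries.le_radius_of_bound _ C
    (r := NNReal.mk R⁻¹ (inv_pos.mpr hR).le) fun n => ?_)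
  · exact ENNReal.coe_pos.mpr (inv_pos.mpr hR)
  · rw [FormalMultilinearSeries.ofScalars_norm, Real.norm_eq_abs, NNReal.coe_mk, inv_pow,
      ← div_eq_mul_inv, div_le_iff₀ (pow_pos hR n)]
    exact hc n

theorem HasFPowerSeriesAt.iteratedDeriv_eq_of_ofScalars {F : ℝ → ℝ} {c : ℕ → ℝ}
    (h : HasFPowerSeriesAt F (FormalMultilinearSeries.ofScalars ℝ c) 0) (n : ℕ) :
    iteratedDeriv n F 0 = n.factorial * c n := by
  have h1 := congrFun (FormalMultilinearSeries.ofScalars_series_injective ℝ ℝ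
    (h.analyticAt.hasFPowerSeriesAt.eq_formalMultilinearSeries h)) n
  rw [← h1]
  field_simp

theorem AnalyticAt.eventuallyEq_of_iteratedDeriv_eq {f g : ℝ → ℝ} (hf : AnalyticAt ℝ f 0)
    (hg : AnalyticAt ℝ g 0) (h : ∀ n, iteratedDeriv n f 0 = iteratedDeriv n g 0) :
    f =ᶠ[𝓝 0] g := by
  have htop : analyticOrderAt (f - g) 0 = ⊤ := by
    refine ENat.eq_top_iff_forall_ge.mpr fun n => ?_
    rw [natCast_le_analyticOrderAt_iff_iteratedDeriv_eq_zero (hf.sub hg)]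
    intro i _
    rw [iteratedDeriv_sub hf.contDiffAt hg.contDiffAt, h i, sub_self]
  exact (analyticOrderAt_eq_top.mp htop).mono fun x hx => sub_eq_zero.mp hx

/-- Analytic functions have analytic local primitives, obtained by integrating the power series. -/
theorem AnalyticAt.exists_analyticAt_deriv_eventuallyEq {g : ℝ → ℝ} (hg : AnalyticAt ℝ g 0) :
    ∃ F : ℝ → ℝ, AnalyticAt ℝ F 0 ∧ deriv F =ᶠ[𝓝 0] g := by
  obtain ⟨C, R, hR, hC⟩ := hg.exists_norm_taylorCoeff_le
  have hC0 : 0 ≤ C := by simpa using (abs_nonneg _).trans (hC 0)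
  obtain ⟨F, hF⟩ := exists_hasFPowerSeriesAt_ofScalars
    (c := fun n => iteratedDeriv (n - 1) g 0 / n.factorial) (C := C * max 1 R⁻¹) hR fun n => by
      rcases n with _ | n
      · have := hC 0
        simp only [pow_zero, mul_one, zero_tsub] at this ⊢
        exact this.trans (le_mul_of_one_le_right hC0 (le_max_left _ _))
      · simp only [add_tsub_cancel_right]
        calc |iteratedDeriv n g 0 / (n + 1).factorial|
            ≤ |iteratedDeriv n g 0 / n.factorial| := by
              rw [abs_div, abs_div, Nat.abs_cast, Nat.abs_cast]
              gcongr
              exact Nat.le_succ n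
          _ ≤ C * R ^ n := hC n
          _ = C * R⁻¹ * R ^ (n + 1) := by field_simp; ring
          _ ≤ C * max 1 R⁻¹ * R ^ (n + 1) := by gcongr; exact le_max_right _ _
  refine ⟨F, hF.analyticAt, hF.analyticAt.deriv.eventuallyEq_of_iteratedDeriv_eq hg fun n => ?_⟩
  rw [← iteratedDeriv_succ', hF.iteratedDeriv_eq_of_ofScalars]
  simp only [add_tsub_cancel_right]
  field_simp

/-- An even analytic function is an analytic function of the square. -/
theorem AnalyticAt.exists_analyticAt_comp_sq {h : ℝ → ℝ} (hh : AnalyticAt ℝ h 0)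
    (heven : ∀ᶠ u in 𝓝 (0 : ℝ), h (-u) = h u) :
    ∃ φ : ℝ → ℝ, AnalyticAt ℝ φ 0 ∧ ∀ᶠ u in 𝓝 (0 : ℝ), h u = φ (u ^ 2) := by
  obtain ⟨C, R, hR, hC⟩ := hh.exists_norm_taylorCoeff_le
  obtain ⟨φ, hφ⟩ := exists_hasFPowerSeriesAt_ofScalars
    (c := fun n => iteratedDeriv (2 * n) h 0 / (2 * n).factorial) (pow_pos hR 2) fun n => by
      rw [← pow_mul]
      exact hC (2 * n)
  refine ⟨φ, hφ.analyticAt, ?_⟩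
  -- Averaging the expansions of `h u` and `h (-u)` leaves the terms of even degree only.
  have hsq : Tendsto (fun u : ℝ => u ^ 2) (𝓝 0) (𝓝 0) :=
    (continuous_pow 2).tendsto' 0 0 (by simp)
  have hneg : Tendsto (fun u : ℝ => -u) (𝓝 0) (𝓝 0) := continuous_neg.tendsto' 0 0 (by simp)
  have h1 := hasFPowerSeriesAt_iff.mp hh.hasFPowerSeriesAt
  filter_upwards [h1, hneg.eventually h1, hsq.eventually (hasFPowerSeriesAt_iff.mp hφ), heven]
    with u hu1 hu2 hu3 hu4
  simp only [FormalMultilinearSeries.coeff_ofScalars, zero_add, smul_eq_mul, hu4] at hu1 hu2 hu3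
  have h5 := (hu1.add hu2).div_const 2
  have h6 := (Function.Injective.hasSum_iff (g := fun n : ℕ => 2 * n)
    (fun m n hmn => by simpa using hmn) ?_).mpr h5
  · rw [add_self_div_two] at h6
    refine h6.unique ?_
    convert! hu3 using 2 with n
    simp only [Function.comp, pow_mul, neg_sq]
    ring
  · intro n hn
    have hodd : Odd n := by
      rw [← Nat.not_even_iff_odd]
      rintro ⟨m, rfl⟩
      exact hn ⟨m, by simp [two_mul]⟩
    rw [hodd.neg_pow]
    ring

theorem AnalyticAt.analyticAt_potential {g : ℝ → ℝ} (hg : AnalyticAt ℝ g 0) :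
    AnalyticAt ℝ (potential g) 0 := by
  obtain ⟨F, hF, hFg⟩ := hg.exists_analyticAt_deriv_eventuallyEq
  obtain ⟨ε, hε, hball⟩ := Metric.eventually_nhds_iff_ball.mp
    (hFg.and (hg.hasDerivAt_potential.and hF.eventually_analyticAt))
  have hsub : ∀ x ∈ Metric.ball (0 : ℝ) ε,
      HasDerivAt (fun y => potential g y - F y) 0 x := fun x hx => by
    obtain ⟨h1, h2, h3⟩ := hball x hx
    simpa [h1] using h2.fun_sub h3.differentiableAt.hasDerivAt
  refine (hF.add (analyticAt_const (v := potential g 0 - F 0))).congr ?_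
  filter_upwards [Metric.ball_mem_nhds 0 hε] with x hx
  have := (convex_ball (0 : ℝ) ε).is_const_of_fderivWithin_eq_zero (𝕜 := ℝ)
    (f := fun y => potential g y - F y)
    (fun y hy => (hsub y hy).differentiableAt.differentiableWithinAt)
    (fun y hy => by
      rw [fderivWithin_of_isOpen Metric.isOpen_ball hy]
      simpa using (hsub y hy).hasFDerivAt.fderiv)
    (Metric.mem_ball_self hε) hx
  simp only [Pi.add_apply] at *
  linarith

/-! ### The Taylor coefficients of `f` -/

/-- The relation `d/dx [G / g ^ 2] = f(G)`, cleared of denominators. -/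
theorem QuotientRelation.eventually_eq {g f : ℝ → ℝ} (hg : AnalyticAt ℝ g 0) (hg0 : g 0 = 0)
    (hg1 : deriv g 0 = 1) (h : QuotientRelation g f) :
    ∀ᶠ x in 𝓝 (0 : ℝ),
      g x ^ 2 - 2 * potential g x * deriv g x = g x ^ 3 * f (potential g x) := by
  have hne : ∀ᶠ x in 𝓝[≠] (0 : ℝ), g x ≠ 0 := by
    have h1 : HasDerivAt g 1 0 := hg1 ▸ hg.differentiableAt.hasDerivAt
    exact h1.eventually_ne one_ne_zero
  have key : ∀ᶠ x in 𝓝[≠] (0 : ℝ),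
      g x ^ 2 - 2 * potential g x * deriv g x = g x ^ 3 * f (potential g x) := by
    filter_upwards [h.2, hne, hg.hasDerivAt_potential.filter_mono nhdsWithin_le_nhds,
      hg.eventually_analyticAt.filter_mono nhdsWithin_le_nhds] with x h1 h2 h3 h4
    have h5 := (h3.div (h4.differentiableAt.hasDerivAt.pow 2) (pow_ne_zero 2 h2))
    have h6 := h1.unique h5
    rw [h6]
    field_simp
    simp
    ring
  rw [eventually_nhdsWithin_iff] at key
  filter_upwards [key] with x hx
  rcases eq_or_ne x 0 with rfl | hx0
  · simp [hg0, potential_zero]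
  · exact hx hx0

/-- The formal Taylor series at `0`. -/
noncomputable def taylorSeries (f : ℝ → ℝ) : PowerSeries ℝ :=
  PowerSeries.mk fun n => iteratedDeriv n f 0 / n.factorial

theorem coeff_taylorSeries (f : ℝ → ℝ) (n : ℕ) :
    PowerSeries.coeff n (taylorSeries f) = iteratedDeriv n f 0 / n.factorial := by
  simp [taylorSeries]

theorem taylorSeries_congr {f h : ℝ → ℝ} (hfh : f =ᶠ[𝓝 0] h) :
    taylorSeries f = taylorSeries h := by
  ext n
  simp only [coeff_taylorSeries, hfh.iteratedDeriv_eq n]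

theorem taylorSeries_mul {f h : ℝ → ℝ} (hf : AnalyticAt ℝ f 0) (hh : AnalyticAt ℝ h 0) :
    taylorSeries (f * h) = taylorSeries f * taylorSeries h := by
  ext n
  rw [PowerSeries.coeff_mul, Finset.Nat.sum_antidiagonal_eq_sum_range_succ_mk, coeff_taylorSeries,
    iteratedDeriv_mul hf.contDiffAt hh.contDiffAt, Finset.sum_div]
  refine Finset.sum_congr rfl fun i hi => ?_
  have hi' : i ≤ n := Nat.lt_succ_iff.mp (Finset.mem_range.mp hi)
  rw [coeff_taylorSeries, coeff_taylorSeries, Nat.cast_choose ℝ hi']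
  have := Nat.factorial_ne_zero n
  field_simp

theorem taylorSeries_add {f h : ℝ → ℝ} (hf : AnalyticAt ℝ f 0) (hh : AnalyticAt ℝ h 0) :
    taylorSeries (f + h) = taylorSeries f + taylorSeries h := by
  ext n
  simp [coeff_taylorSeries, iteratedDeriv_add hf.contDiffAt hh.contDiffAt, add_div]

theorem taylorSeries_sub {f h : ℝ → ℝ} (hf : AnalyticAt ℝ f 0) (hh : AnalyticAt ℝ h 0) :
    taylorSeries (f - h) = taylorSeries f - taylorSeries h := by
  ext n
  simp [coeff_taylorSeries, iteratedDeriv_sub hf.contDiffAt hh.contDiffAt, sub_div]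

theorem taylorSeries_const_mul (c : ℝ) {f : ℝ → ℝ} :
    taylorSeries (fun x => c * f x) = PowerSeries.C c * taylorSeries f := by
  ext n
  simp [coeff_taylorSeries, mul_div_assoc]

theorem coeff_taylorSeries_deriv (f : ℝ → ℝ) (n : ℕ) :
    PowerSeries.coeff n (taylorSeries (deriv f)) = iteratedDeriv (n + 1) f 0 / n.factorial := by
  rw [coeff_taylorSeries, iteratedDeriv_succ']

theorem coeff_taylorSeries_potential_succ {g : ℝ → ℝ} (hg : AnalyticAt ℝ g 0) (n : ℕ) :
    PowerSeries.coeff (n + 1) (taylorSeries (potential g)) =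
      iteratedDeriv n g 0 / (n + 1).factorial := by
  rw [coeff_taylorSeries, iteratedDeriv_succ', hg.deriv_potential.iteratedDeriv_eq n]

open PowerSeries in
/-- The Taylor series of `f ∘ G` modulo `G ^ 3`; the last term matters only through its order. -/
theorem exists_taylorSeries_comp {f G : ℝ → ℝ} (hf : AnalyticAt ℝ f 0) (hG : AnalyticAt ℝ G 0)
    (hG0 : G 0 = 0) :
    ∃ S : PowerSeries ℝ, taylorSeries (f ∘ G) = C (f 0) + C (deriv f 0) * taylorSeries G +
      C (iteratedDeriv 2 f 0 / 2) * taylorSeries G ^ 2 + taylorSeries G ^ 3 * S := by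
  obtain ⟨F, hF, hfF⟩ := hf.exists_eq_sum_add_pow_mul 3
  have hFG : AnalyticAt ℝ (F ∘ G) 0 := AnalyticAt.comp (by rwa [hG0]) hG
  refine ⟨taylorSeries (F ∘ G), ?_⟩
  have hG2 : AnalyticAt ℝ (G * G) 0 := hG.mul hG
  have hG3 : AnalyticAt ℝ (G * (G * G)) 0 := hG.mul hG2
  have h0 : AnalyticAt ℝ (fun _ : ℝ => f 0) 0 := analyticAt_const
  have h1 : AnalyticAt ℝ (fun x => deriv f 0 * G x) 0 := analyticAt_const.mul hG
  have h2 : AnalyticAt ℝ (fun x => iteratedDeriv 2 f 0 / 2 * (G * G) x) 0 :=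
    analyticAt_const.mul hG2
  have hc : taylorSeries (fun _ : ℝ => f 0) = C (f 0) := by
    ext n
    rw [coeff_taylorSeries, iteratedDeriv_const, PowerSeries.coeff_C]
    split_ifs with h <;> simp [h]
  have hdec : f ∘ G = (((fun _ : ℝ => f 0) + fun x => deriv f 0 * G x) +
      fun x => iteratedDeriv 2 f 0 / 2 * (G * G) x) + (G * (G * G)) * (F ∘ G) := by
    funext x
    simp only [Function.comp, hfF (G x), Finset.sum_range_succ, Finset.sum_range_zero,
      iteratedDeriv_zero, iteratedDeriv_one, smul_eq_mul, Pi.add_apply, Pi.mul_apply,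
      Nat.factorial]
    push_cast
    ring
  rw [hdec, taylorSeries_add ((h0.add h1).add h2) (hG3.mul hFG), taylorSeries_add (h0.add h1) h2,
    taylorSeries_add h0 h1, taylorSeries_mul hG3 hFG, taylorSeries_mul hG hG2, hc,
    taylorSeries_const_mul, taylorSeries_const_mul, taylorSeries_mul hG hG]
  ring

open PowerSeries in
theorem QuotientRelation.taylorSeries_eq {g f : ℝ → ℝ} (hg : AnalyticAt ℝ g 0) (hg0 : g 0 = 0)
    (hg1 : deriv g 0 = 1) (h : QuotientRelation g f) :
    taylorSeries g ^ 2 - C 2 * (taylorSeries (potential g) * taylorSeries (deriv g)) =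
      taylorSeries g ^ 3 * taylorSeries (f ∘ potential g) := by
  have hG := hg.analyticAt_potential
  have hfG : AnalyticAt ℝ (f ∘ potential g) 0 :=
    AnalyticAt.comp (by rw [potential_zero]; exact h.1) hG
  have hE : g * g - (fun x => 2 * (potential g * deriv g) x) =ᶠ[𝓝 0]
      (g * (g * g)) * (f ∘ potential g) := by
    filter_upwards [h.eventually_eq hg hg0 hg1] with x hx
    simp only [Pi.sub_apply, Pi.mul_apply, Function.comp]
    linear_combination hx
  have hT := taylorSeries_congr hE
  have h2 : AnalyticAt ℝ (fun x => 2 * (potential g * deriv g) x) 0 :=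
    analyticAt_const.mul (hG.mul hg.deriv)
  rw [taylorSeries_sub (hg.mul hg) h2,
    taylorSeries_const_mul, taylorSeries_mul hG hg.deriv,
    taylorSeries_mul (hg.mul (hg.mul hg)) hfG, taylorSeries_mul hg (hg.mul hg),
    taylorSeries_mul hg hg] at hT
  linear_combination hT

set_option maxHeartbeats 1000000 in
set_option linter.unusedSimpArgs false in
open PowerSeries in
/-- The three initial derivatives of `f` come from the coefficients of `x ^ 3`, `x ^ 5`, `x ^ 7` in
the cleared relation; those of `x ^ 4`, `x ^ 6` are constraints on `g`, which express its third and
fifth derivatives through the second and fourth. -/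
theorem QuotientRelation.initial_derivatives {g f : ℝ → ℝ} (hg : AnalyticAt ℝ g 0) (hg0 : g 0 = 0)
    (hg1 : deriv g 0 = 1) (h : QuotientRelation g f) :
    f 0 = -iteratedDeriv 2 g 0 / 3 ∧
      deriv f 0 = 7 / 9 * iteratedDeriv 2 g 0 ^ 3 - iteratedDeriv 4 g 0 / 5 ∧
      iteratedDeriv 2 f 0 = -(1 / 21) * iteratedDeriv 6 g 0
        - 310 / 54 * iteratedDeriv 2 g 0 ^ 5
        + 2 * iteratedDeriv 2 g 0 ^ 2 * iteratedDeriv 4 g 0 := by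
  obtain ⟨S, hS⟩ := exists_taylorSeries_comp h.1 hg.analyticAt_potential (potential_zero g)
  have hE := h.taylorSeries_eq hg hg0 hg1
  rw [hS] at hE
  have hP := coeff_taylorSeries g
  have hD := coeff_taylorSeries_deriv g
  have hQ := coeff_taylorSeries_potential_succ hg
  have hQ0 : coeff 0 (taylorSeries (potential g)) = 0 := by
    simp [coeff_taylorSeries, potential_zero]
  generalize taylorSeries g = P at *
  generalize taylorSeries (deriv g) = D at *
  generalize taylorSeries (potential g) = Q at *
  have hP0 := hP 0; have hP1 := hP 1; have hP2 := hP 2; have hP3 := hP 3; have hP4 := hP 4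
  have hP5 := hP 5; have hP6 := hP 6
  have hQ1 := hQ 0; have hQ2 := hQ 1; have hQ3 := hQ 2; have hQ4 := hQ 3; have hQ5 := hQ 4
  have hQ6 := hQ 5; have hQ7 := hQ 6
  have hD0 := hD 0; have hD1 := hD 1; have hD2 := hD 2; have hD3 := hD 3; have hD4 := hD 4
  have hD5 := hD 5
  have hEn := fun n => congrArg (coeff n) hE
  clear hP hQ hD hE hS
  generalize iteratedDeriv 2 g 0 = g2 at *
  generalize iteratedDeriv 3 g 0 = g3 at *
  generalize iteratedDeriv 4 g 0 = g4 at *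
  generalize iteratedDeriv 5 g 0 = g5 at *
  generalize iteratedDeriv 6 g 0 = g6 at *
  generalize f 0 = f0 at *
  generalize deriv f 0 = f1 at *
  generalize iteratedDeriv 2 f 0 = f2 at *
  simp only [iteratedDeriv_zero, iteratedDeriv_one, hg0, hg1, Nat.factorial, Nat.reduceMul,
    Nat.reduceAdd, Nat.cast_ofNat, Nat.cast_one, zero_add, div_one, Nat.succ_eq_add_one]
    at hP0 hP1 hP2 hP3 hP4 hP5 hP6 hQ1 hQ2 hQ3 hQ4 hQ5 hQ6 hQ7 hD0 hD1 hD2 hD3 hD4 hD5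
  have mulc (A B : ℝ⟦X⟧) (n : ℕ) :
      coeff n (A * B) = ∑ k ∈ Finset.range (n + 1), coeff k A * coeff (n - k) B := by
    rw [coeff_mul, Finset.Nat.sum_antidiagonal_eq_sum_range_succ_mk]
  -- The powers of `P` and `Q` are expanded one factor at a time, up to the orders that reach the
  -- coefficient of `x ^ 7`.
  have hPP0 := mulc P P 0; have hPP1 := mulc P P 1; have hPP2 := mulc P P 2; have hPP3 := mulc P P 3
  have hPP4 := mulc P P 4; have hPP5 := mulc P P 5; have hPP6 := mulc P P 6; have hPP7 := mulc P P 7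
  simp only [Finset.sum_range_succ, Finset.sum_range_zero, Nat.reduceSub, tsub_zero, tsub_self,
    zero_mul, mul_zero, zero_add, add_zero, one_mul, mul_one, hP0, hP1, hP2, hP3, hP4, hP5, hP6]
    at hPP0 hPP1 hPP2 hPP3 hPP4 hPP5 hPP6 hPP7
  have hPPP0 := mulc P (P * P) 0; have hPPP1 := mulc P (P * P) 1
  have hPPP2 := mulc P (P * P) 2; have hPPP3 := mulc P (P * P) 3
  have hPPP4 := mulc P (P * P) 4; have hPPP5 := mulc P (P * P) 5
  have hPPP6 := mulc P (P * P) 6; have hPPP7 := mulc P (P * P) 7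
  simp only [Finset.sum_range_succ, Finset.sum_range_zero, Nat.reduceSub, tsub_zero, tsub_self,
    zero_mul, mul_zero, zero_add, add_zero, one_mul, mul_one, hP0, hP1, hP2, hP3, hP4, hP5, hP6,
    hPP0, hPP1, hPP2, hPP3, hPP4, hPP5, hPP6, hPP7]
    at hPPP0 hPPP1 hPPP2 hPPP3 hPPP4 hPPP5 hPPP6 hPPP7
  have hQQ0 := mulc Q Q 0; have hQQ1 := mulc Q Q 1; have hQQ2 := mulc Q Q 2; have hQQ3 := mulc Q Q 3
  have hQQ4 := mulc Q Q 4
  simp only [Finset.sum_range_succ, Finset.sum_range_zero, Nat.reduceSub, tsub_zero, tsub_self,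
    zero_mul, mul_zero, zero_add, add_zero, one_mul, mul_one, hQ0, hQ1, hQ2, hQ3, hQ4, hQ5, hQ6,
    hQ7]
    at hQQ0 hQQ1 hQQ2 hQQ3 hQQ4
  have hQQQ0 := mulc Q (Q * Q) 0; have hQQQ1 := mulc Q (Q * Q) 1
  have hQQQ2 := mulc Q (Q * Q) 2; have hQQQ3 := mulc Q (Q * Q) 3
  have hQQQ4 := mulc Q (Q * Q) 4
  simp only [Finset.sum_range_succ, Finset.sum_range_zero, Nat.reduceSub, tsub_zero, tsub_self,
    zero_mul, mul_zero, zero_add, add_zero, one_mul, mul_one, hQ0, hQ1, hQ2, hQ3, hQ4, hQ5, hQ6,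
    hQ7, hQQ0, hQQ1, hQQ2, hQQ3, hQQ4]
    at hQQQ0 hQQQ1 hQQQ2 hQQQ3 hQQQ4
  have hQQQS0 := mulc (Q * (Q * Q)) S 0; have hQQQS1 := mulc (Q * (Q * Q)) S 1
  have hQQQS2 := mulc (Q * (Q * Q)) S 2; have hQQQS3 := mulc (Q * (Q * Q)) S 3
  have hQQQS4 := mulc (Q * (Q * Q)) S 4
  simp only [Finset.sum_range_succ, Finset.sum_range_zero, Nat.reduceSub, tsub_zero, tsub_self,
    zero_mul, mul_zero, zero_add, add_zero, one_mul, mul_one, hQQQ0, hQQQ1, hQQQ2, hQQQ3, hQQQ4]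
    at hQQQS0 hQQQS1 hQQQS2 hQQQS3 hQQQS4
  have hW (n : ℕ) : coeff n (C f0 + C f1 * Q + C (f2 / 2) * Q ^ 2 + Q ^ 3 * S) =
      (if n = 0 then f0 else 0) + f1 * coeff n Q + f2 / 2 * coeff n (Q * Q) +
        coeff n (Q * (Q * Q) * S) := by
    rw [show Q ^ 2 = Q * Q by ring, show Q ^ 3 = Q * (Q * Q) by ring]
    simp only [map_add, coeff_C_mul, coeff_C]
  have hE (n : ℕ) : coeff n (P * P) - 2 * coeff n (Q * D) =
      coeff n ((P * (P * P)) * (C f0 + C f1 * Q + C (f2 / 2) * Q ^ 2 + Q ^ 3 * S)) := by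
    rw [← coeff_C_mul, ← map_sub, show P * (P * P) = P ^ 3 by ring, ← hEn n, pow_two]
  generalize C f0 + C f1 * Q + C (f2 / 2) * Q ^ 2 + Q ^ 3 * S = W at *
  have hW0 := hW 0; have hW1 := hW 1; have hW2 := hW 2; have hW3 := hW 3; have hW4 := hW 4
  simp only [OfNat.ofNat_ne_zero, one_ne_zero, if_true, if_false, mul_zero, zero_add, add_zero,
    hQ0, hQ1, hQ2, hQ3, hQ4, hQ5, hQ6, hQ7, hQQ0, hQQ1, hQQ2, hQQ3, hQQ4, hQQQS0, hQQQS1, hQQQS2,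
    hQQQS3, hQQQS4]
    at hW0 hW1 hW2 hW3 hW4
  have e3 := hE 3; have e4 := hE 4; have e5 := hE 5; have e6 := hE 6; have e7 := hE 7
  simp only [mulc, Finset.sum_range_succ, Finset.sum_range_zero, Nat.reduceSub, tsub_zero,
    tsub_self, zero_mul, mul_zero, zero_add, add_zero, one_mul, mul_one, hP0, hP1, hP2, hP3, hP4,
    hP5, hP6, hQ0, hQ1, hQ2, hQ3, hQ4, hQ5, hQ6, hQ7, hD0, hD1, hD2, hD3, hD4, hD5, hPPP0, hPPP1,
    hPPP2, hPPP3, hPPP4, hPPP5, hPPP6, hPPP7, hW0, hW1, hW2, hW3, hW4]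
    at e3 e4 e5 e6 e7
  clear * - e3 e4 e5 e6 e7
  -- Each equation is solved for the one quantity it introduces.
  obtain rfl : f0 = -g2 / 3 := by linear_combination -e3
  obtain rfl : g3 = 5 / 3 * g2 ^ 2 := by linear_combination -4 * e4
  obtain rfl : f1 = 7 / 9 * g2 ^ 3 - g4 / 5 := by linear_combination -2 * e5
  obtain rfl : g5 = 7 * g2 * g4 - 140 / 9 * g2 ^ 4 := by linear_combination -36 * e6
  exact ⟨rfl, rfl, by linear_combination -8 * e7⟩

/-! ### Dependence of the derivatives of `f` on the jet of `g` -/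

theorem AnalyticAt.isBigO_pow_of_iteratedDeriv_eq_zero {f : ℝ → ℝ} (hf : AnalyticAt ℝ f 0) {n : ℕ}
    (h : ∀ k < n, iteratedDeriv k f 0 = 0) : f =O[𝓝 0] fun x => x ^ n := by
  obtain ⟨F, hF, hfF⟩ := hf.exists_eventuallyEq_sum_add_pow_mul n
  have h1 : f =ᶠ[𝓝 0] fun x => x ^ n * F x := by
    filter_upwards [hfF] with x hx
    rw [hx, Finset.sum_eq_zero fun i hi => by rw [h i (Finset.mem_range.mp hi), smul_zero],
      zero_add, smul_eq_mul]
  have h2 := (isBigO_refl (fun x : ℝ => x ^ n) (𝓝 0)).mul (hF.continuousAt.isBigO_one ℝ)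
  simp only [mul_one] at h2
  exact h1.trans_isBigO h2

theorem not_isBigO_pow_pow {m n : ℕ} (hmn : m < n) :
    ¬ (fun x : ℝ => x ^ m) =O[𝓝 0] fun x : ℝ => x ^ n := by
  intro h
  have h1 : (fun x : ℝ => x ^ n) =o[𝓝 0] fun x : ℝ => x ^ m := isLittleO_pow_pow hmn
  refine isLittleO_irrefl ?_ (h.trans_isLittleO h1)
  have h2 : ∃ᶠ x : ℝ in 𝓝[≠] 0, x ^ m ≠ 0 :=
    Eventually.frequently <| eventually_mem_nhdsWithin.mono fun x (hx : x ∈ ({0}ᶜ : Set ℝ)) =>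
      pow_ne_zero m hx
  exact h2.filter_mono nhdsWithin_le_nhds

theorem pow_isBigO_of_eventually_eq_mul {f e : ℝ → ℝ} {m : ℕ} (he : ContinuousAt e 0)
    (he0 : e 0 ≠ 0) (h : ∀ᶠ x in 𝓝 (0 : ℝ), f x = x ^ m * e x) :
    (fun x : ℝ => x ^ m) =O[𝓝 0] f := by
  have h2 := (isBigO_refl f (𝓝 0)).mul ((he.inv₀ he0).isBigO_one ℝ)
  simp only [mul_one] at h2
  refine EventuallyEq.trans_isBigO ?_ h2
  filter_upwards [h, he.eventually_ne he0] with x hx hx0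
  rw [hx, mul_assoc, Pi.inv_apply, mul_inv_cancel₀ hx0, mul_one]

/-- If `x ^ j * d (G x)` vanishes to order `2 n + 1 + j` and `G` vanishes to order at most `2`, then
`d` vanishes to order `n + 1`. -/
theorem AnalyticAt.iteratedDeriv_eq_zero_of_comp_isBigO {d G : ℝ → ℝ}
    (hd : AnalyticAt ℝ d 0) (hG : Tendsto G (𝓝 0) (𝓝 0))
    (hG2 : (fun x : ℝ => x ^ 2) =O[𝓝 0] G) {j n : ℕ}
    (h : (fun x => x ^ j * d (G x)) =O[𝓝 0] fun x => x ^ (2 * n + 1 + j)) :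
    iteratedDeriv n d 0 = 0 := by
  have hle : ((n + 1 : ℕ) : ℕ∞) ≤ analyticOrderAt d 0 := by
    by_contra! hlt
    obtain ⟨m, hm⟩ := ENat.ne_top_iff_exists.mp hlt.ne_top
    obtain ⟨e, he, he0, hde⟩ := hd.analyticOrderAt_eq_natCast.mp hm.symm
    rw [← hm, Nat.cast_lt] at hlt
    have h1 : (fun s : ℝ => s ^ m) =O[𝓝 0] d :=
      pow_isBigO_of_eventually_eq_mul he.continuousAt he0 (by simpa using hde)
    have h3 : (fun x : ℝ => x ^ (j + 2 * m)) =O[𝓝 0] fun x : ℝ => x ^ (2 * n + 1 + j) := by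
      simp only [pow_add _ j, pow_mul]
      exact ((isBigO_refl _ _).mul ((hG2.pow m).trans (h1.comp_tendsto hG))).trans h
    exact not_isBigO_pow_pow (by omega) h3
  exact (natCast_le_analyticOrderAt_iff_iteratedDeriv_eq_zero hd).mp hle n (Nat.lt_succ_self n)

theorem AnalyticAt.exists_potential_eq_sq_mul {g : ℝ → ℝ} (hg : AnalyticAt ℝ g 0) (hg0 : g 0 = 0)
    (hg1 : deriv g 0 = 1) : ∃ H : ℝ → ℝ, AnalyticAt ℝ H 0 ∧ H 0 = 1 / 2 ∧
      ∀ᶠ x in 𝓝 (0 : ℝ), potential g x = x ^ 2 * H x := by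
  obtain ⟨F, hF, hGF⟩ := hg.analyticAt_potential.exists_eventuallyEq_sum_add_pow_mul 3
  refine ⟨fun x => 1 / 2 + x * F x, analyticAt_const.add (analyticAt_id.mul hF), by simp, ?_⟩
  have h1 : iteratedDeriv 1 (potential g) 0 = 0 := by
    rw [iteratedDeriv_one, hg.deriv_potential.eq_of_nhds, hg0]
  have h2 : iteratedDeriv 2 (potential g) 0 = 1 := by
    rw [iteratedDeriv_succ', hg.deriv_potential.iteratedDeriv_eq, iteratedDeriv_one, hg1]
  filter_upwards [hGF] with x hx
  rw [hx]
  simp only [Finset.sum_range_succ, Finset.sum_range_zero, iteratedDeriv_zero, h1, h2,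
    potential_zero, Nat.factorial, smul_eq_mul]
  push_cast
  ring

/-- If the data agree to order `2 n + 2`, then subtracting the two cleared relations shows that
`g ^ 3 * (f - f₁) (G)` vanishes to order `2 n + 4`; since `g` and `G` have order `1` and `2`, the
function `f - f₁` vanishes to order `n + 1`. -/
theorem QuotientRelation.iteratedDeriv_eq {g f g₁ f₁ : ℝ → ℝ}
    (hg : AnalyticAt ℝ g 0) (hg0 : g 0 = 0) (hg1 : deriv g 0 = 1) (h : QuotientRelation g f)
    (hg' : AnalyticAt ℝ g₁ 0) (hg0' : g₁ 0 = 0) (hg1' : deriv g₁ 0 = 1)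
    (h' : QuotientRelation g₁ f₁) {n : ℕ}
    (hjet : ∀ k ≤ 2 * n + 2, iteratedDeriv k g 0 = iteratedDeriv k g₁ 0) :
    iteratedDeriv n f 0 = iteratedDeriv n f₁ 0 := by
  have hG := hg.analyticAt_potential
  have hG' := hg'.analyticAt_potential
  have hG0 : Tendsto (potential g) (𝓝 0) (𝓝 0) := by
    simpa [potential_zero] using hG.continuousAt.tendsto
  have hG0' : Tendsto (potential g₁) (𝓝 0) (𝓝 0) := by
    simpa [potential_zero] using hG'.continuousAt.tendsto
  have ho : ∀ {u : ℝ → ℝ}, AnalyticAt ℝ u 0 → u =O[𝓝 0] fun _ => (1 : ℝ) := fun hu =>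
    hu.continuousAt.isBigO_one ℝ
  -- The differences of the two data.
  have dg : (g - g₁) =O[𝓝 0] fun x => x ^ (2 * n + 3) :=
    (hg.sub hg').isBigO_pow_of_iteratedDeriv_eq_zero fun k hk => by
      rw [iteratedDeriv_sub hg.contDiffAt hg'.contDiffAt, hjet k (by omega), sub_self]
  have dg' : (deriv g - deriv g₁) =O[𝓝 0] fun x => x ^ (2 * n + 2) :=
    (hg.deriv.sub hg'.deriv).isBigO_pow_of_iteratedDeriv_eq_zero fun k hk => by
      rw [iteratedDeriv_sub hg.deriv.contDiffAt hg'.deriv.contDiffAt, ← iteratedDeriv_succ',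
        ← iteratedDeriv_succ', hjet (k + 1) (by omega), sub_self]
  have dG : (potential g - potential g₁) =O[𝓝 0] fun x => x ^ (2 * n + 4) :=
    (hG.sub hG').isBigO_pow_of_iteratedDeriv_eq_zero fun k hk => by
      rw [iteratedDeriv_sub hG.contDiffAt hG'.contDiffAt]
      rcases k with _ | k
      · simp [potential_zero]
      · rw [iteratedDeriv_succ', iteratedDeriv_succ', hg.deriv_potential.iteratedDeriv_eq,
          hg'.deriv_potential.iteratedDeriv_eq, hjet k (by omega), sub_self]
  have og : g =O[𝓝 0] fun x => x ^ 1 := hg.isBigO_pow_of_iteratedDeriv_eq_zero fun k hk => by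
    simpa [Nat.lt_one_iff.mp hk] using hg0
  have og' : g₁ =O[𝓝 0] fun x => x ^ 1 := hg'.isBigO_pow_of_iteratedDeriv_eq_zero fun k hk => by
    simpa [Nat.lt_one_iff.mp hk] using hg0'
  have oG : potential g =O[𝓝 0] fun x => x ^ 2 :=
    hG.isBigO_pow_of_iteratedDeriv_eq_zero fun k hk => by
      interval_cases k
      · simp [potential_zero]
      · rw [iteratedDeriv_one, hg.deriv_potential.eq_of_nhds, hg0]
  have df : (fun x => f₁ (potential g x) - f₁ (potential g₁ x)) =O[𝓝 0]
      fun x => x ^ (2 * n + 4) := by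
    have h1 := (h'.1.hasStrictDerivAt.hasStrictFDerivAt.isBigO_sub).comp_tendsto
      (hG0.prodMk_nhds hG0')
    exact h1.trans dG
  have hgx : (fun x : ℝ => x ^ 1) =O[𝓝 0] g := by
    obtain ⟨F, hF, hgF⟩ := hg.exists_eventuallyEq_sum_add_pow_mul 2
    refine pow_isBigO_of_eventually_eq_mul (e := fun x => 1 + x * F x)
      (analyticAt_const.add (analyticAt_id.mul hF)).continuousAt (by simp) ?_
    filter_upwards [hgF] with x hx
    rw [hx]
    simp only [Finset.sum_range_succ, Finset.sum_range_zero, iteratedDeriv_zero, iteratedDeriv_one,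
      hg0, hg1, Nat.factorial, smul_eq_mul]
    push_cast
    ring
  obtain ⟨H, hH, hH0, hGH⟩ := hg.exists_potential_eq_sq_mul hg0 hg1
  have hGx : (fun x : ℝ => x ^ 2) =O[𝓝 0] potential g :=
    pow_isBigO_of_eventually_eq_mul hH.continuousAt (by rw [hH0]; norm_num) hGH
  have hf₁G' : AnalyticAt ℝ (f₁ ∘ potential g₁) 0 :=
    AnalyticAt.comp (by rw [potential_zero]; exact h'.1) hG'
  -- Subtract the two cleared relations and isolate `g ^ 3 * (f - f₁) (G)`.
  have key : (fun x => g x ^ 3 * (f - f₁) (potential g x)) =O[𝓝 0]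
      fun x => x ^ (2 * n + 4) := by
    have t1 : (fun x => (g - g₁) x * (g x + g₁ x)) =O[𝓝 0] fun x => x ^ (2 * n + 4) :=
      (dg.mul (og.add og')).congr_right fun x => by ring
    have t2 : (fun x => potential g x * (deriv g - deriv g₁) x) =O[𝓝 0]
        fun x => x ^ (2 * n + 4) := (oG.mul dg').congr_right fun x => by ring
    have t3 : (fun x => (potential g - potential g₁) x * deriv g₁ x) =O[𝓝 0]
        fun x => x ^ (2 * n + 4) := (dG.mul (ho hg'.deriv)).congr_right fun x => by ring
    have t4 : (fun x => g x ^ 3 * (f₁ (potential g x) - f₁ (potential g₁ x))) =O[𝓝 0]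
        fun x => x ^ (2 * n + 4) := ((ho (hg.pow 3)).mul df).congr_right fun x => by ring
    have t5 : (fun x => (g - g₁) x * (g x * g x + g x * g₁ x + g₁ x * g₁ x) *
        f₁ (potential g₁ x)) =O[𝓝 0] fun x => x ^ (2 * n + 4) := by
      have o1 : (fun x => g x * g x + g x * g₁ x + g₁ x * g₁ x) =O[𝓝 0] fun x => x ^ 1 :=
        (((ho hg).mul og).congr_right fun x => by ring).add
          (((ho hg).mul og').congr_right fun x => by ring) |>.add
          (((ho hg').mul og').congr_right fun x => by ring)
      exact ((dg.mul o1).mul (ho hf₁G')).congr_right fun x => by ring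
    refine EventuallyEq.trans_isBigO ?_ ((((t1.sub (t2.const_mul_left 2)).sub
      (t3.const_mul_left 2)).sub t4).sub t5)
    filter_upwards [h.eventually_eq hg hg0 hg1, h'.eventually_eq hg' hg0' hg1'] with x hx hx'
    simp only [Pi.sub_apply]
    linear_combination hx' - hx
  have hcomp : (fun x => x ^ 3 * (f - f₁) (potential g x)) =O[𝓝 0]
      fun x => x ^ (2 * n + 1 + 3) := by
    refine IsBigO.trans ?_ key
    simpa using (hgx.pow 3).mul (isBigO_refl (fun x => (f - f₁) (potential g x)) (𝓝 0))
  have h0 := (h.1.sub h'.1).iteratedDeriv_eq_zero_of_comp_isBigO hG0 hGx hcomp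
  rwa [iteratedDeriv_sub h.1.contDiffAt h'.1.contDiffAt, sub_eq_zero] at h0

/-! ### The energy coordinate -/

/-- `X` is the inverse, near the origin, of the coordinate `U x = ± √(2 G x)`, in which the energy
`y ^ 2 / 2 + G x` of the system is `(y ^ 2 + u ^ 2) / 2`. -/
structure IsEnergyChart (g X U : ℝ → ℝ) : Prop where
  analyticAt_inv : AnalyticAt ℝ X 0
  analyticAt : AnalyticAt ℝ U 0
  inv_zero : X 0 = 0
  map_zero : U 0 = 0
  deriv_inv_zero : deriv X 0 = 1
  left_inv : ∀ᶠ u in 𝓝 (0 : ℝ), U (X u) = u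
  right_inv : ∀ᶠ x in 𝓝 (0 : ℝ), X (U x) = x
  energy : ∀ᶠ x in 𝓝 (0 : ℝ), 2 * potential g x = U x ^ 2

theorem exists_isEnergyChart {g : ℝ → ℝ} (hg : AnalyticAt ℝ g 0) (hg0 : g 0 = 0)
    (hg1 : deriv g 0 = 1) : ∃ X U : ℝ → ℝ, IsEnergyChart g X U := by
  obtain ⟨H, hH, hH0, hGH⟩ := hg.exists_potential_eq_sq_mul hg0 hg1
  have hpos : 0 < 2 * H 0 := by rw [hH0]; norm_num
  -- `√(2 H)`, written through `exp` and `log`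
  have hk : AnalyticAt ℝ (fun x => Real.exp (Real.log (2 * H x) / 2)) 0 :=
    (((analyticAt_const.mul hH).log hpos).div_const).rexp
  set U : ℝ → ℝ := fun x => x * Real.exp (Real.log (2 * H x) / 2) with hU
  have hUa : AnalyticAt ℝ U 0 := analyticAt_id.mul hk
  have hU0 : U 0 = 0 := by simp [hU]
  have hU1 : HasDerivAt U 1 0 := by
    have := (hasDerivAt_id' (0 : ℝ)).fun_mul hk.differentiableAt.hasDerivAt
    simpa [hH0] using this
  have hne : deriv U 0 ≠ 0 := by rw [hU1.deriv]; exact one_ne_zero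
  refine ⟨hUa.hasStrictDerivAt.localInverse _ _ _ hne, U, ?_, hUa, ?_, hU0, ?_, ?_, ?_, ?_⟩
  · simpa only [hU0] using hUa.analyticAt_localInverse hne
  · have := (hUa.hasStrictDerivAt.eventually_left_inverse hne).self_of_nhds
    rwa [hU0] at this
  · have := hUa.hasStrictDerivAt.to_localInverse hne
    rw [hU0] at this
    rw [this.hasDerivAt.deriv, hU1.deriv, inv_one]
  · have := hUa.hasStrictDerivAt.eventually_right_inverse hne
    rwa [hU0] at this
  · exact hUa.hasStrictDerivAt.eventually_left_inverse hne
  · filter_upwards [hGH, (hH.continuousAt.const_mul 2).eventually (lt_mem_nhds hpos)] with x hx hx'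
    rw [hx, hU, mul_pow, ← Real.exp_nat_mul]
    rw [show ((2 : ℕ) : ℝ) * (Real.log (2 * H x) / 2) = Real.log (2 * H x) by push_cast; ring,
      Real.exp_log hx']
    ring

namespace IsEnergyChart

variable {g X U : ℝ → ℝ}

theorem tendsto_inv (h : IsEnergyChart g X U) : Tendsto X (𝓝 0) (𝓝 0) := by
  simpa [h.inv_zero] using h.analyticAt_inv.continuousAt.tendsto

theorem tendsto (h : IsEnergyChart g X U) : Tendsto U (𝓝 0) (𝓝 0) := by
  simpa [h.map_zero] using h.analyticAt.continuousAt.tendsto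

theorem energy_inv (h : IsEnergyChart g X U) :
    ∀ᶠ u in 𝓝 (0 : ℝ), 2 * potential g (X u) = u ^ 2 := by
  filter_upwards [h.tendsto_inv.eventually h.energy, h.left_inv] with u h1 h2
  rw [h1, h2]

theorem map_mul_deriv_inv (h : IsEnergyChart g X U) (hg : AnalyticAt ℝ g 0) :
    ∀ᶠ u in 𝓝 (0 : ℝ), g (X u) * deriv X u = u := by
  filter_upwards [h.energy_inv.eventually_nhds, h.tendsto_inv.eventually hg.hasDerivAt_potential,
    h.analyticAt_inv.eventually_analyticAt] with u h1 h2 h3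
  have h4 := (h2.comp u h3.differentiableAt.hasDerivAt).const_mul 2
  have h5 : HasDerivAt (fun v : ℝ => v ^ 2) (2 * u) u := by simpa using hasDerivAt_pow 2 u
  have h6 := (h5.congr_of_eventuallyEq h1).unique h4
  linarith

theorem deriv_inv_mul_deriv (h : IsEnergyChart g X U) :
    ∀ᶠ x in 𝓝 (0 : ℝ), deriv X (U x) * deriv U x = 1 := by
  filter_upwards [h.right_inv.eventually_nhds, h.analyticAt.eventually_analyticAt,
    h.tendsto.eventually h.analyticAt_inv.eventually_analyticAt] with x h1 h2 h3
  have h4 := h3.differentiableAt.hasDerivAt.comp x h2.differentiableAt.hasDerivAt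
  exact ((hasDerivAt_id x).congr_of_eventuallyEq h1).unique h4 |>.symm

/-- In the energy coordinate, `G / g ^ 2 = X' ^ 2 / 2`, whose derivative with respect to `x` is
`X''`. -/
theorem hasDerivAt_quotient (h : IsEnergyChart g X U) (hg : AnalyticAt ℝ g 0) :
    ∀ᶠ x in 𝓝[≠] (0 : ℝ),
      HasDerivAt (fun s => potential g s / g s ^ 2) (deriv (deriv X) (U x)) x := by
  have hquot : ∀ᶠ s in 𝓝 (0 : ℝ), s ≠ 0 → potential g s / g s ^ 2 = deriv X (U s) ^ 2 / 2 := by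
    filter_upwards [h.energy, h.tendsto.eventually (h.map_mul_deriv_inv hg), h.right_inv]
      with s h1 h2 h3 hs
    rw [h3] at h2
    have hU : U s ≠ 0 := fun h0 => hs (by rw [← h3, h0, h.inv_zero])
    have hgs : g s ≠ 0 := fun h0 => hU (by rw [← h2, h0, zero_mul])
    rw [div_eq_div_iff (pow_ne_zero 2 hgs) two_ne_zero, mul_comm _ (2 : ℝ), h1]
    linear_combination -(U s + g s * deriv X (U s)) * h2
  rw [eventually_nhdsWithin_iff]
  filter_upwards [hquot.eventually_nhds, h.deriv_inv_mul_deriv, h.analyticAt.eventually_analyticAt,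
    h.tendsto.eventually h.analyticAt_inv.deriv.eventually_analyticAt] with x h1 h2 h3 h4 hx
  have h5 := ((h4.differentiableAt.hasDerivAt.comp x
    h3.differentiableAt.hasDerivAt).pow 2).div_const 2
  have h6 : (fun s => potential g s / g s ^ 2) =ᶠ[𝓝 x]
      fun s => ((deriv X ∘ U) ^ 2) s / 2 := by
    filter_upwards [h1, eventually_ne_nhds hx] with s hs hs0
    exact hs hs0
  refine (h5.congr_of_eventuallyEq h6).congr_deriv ?_
  simp only [Function.comp, Nat.cast_ofNat, Nat.add_one_sub_one, pow_one]
  linear_combination deriv (deriv X) (U x) * h2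

/-- In the energy coordinate the quotient relation is `X'' u = f (u ^ 2 / 2)`. -/
theorem quotientRelation_iff (h : IsEnergyChart g X U) (hg : AnalyticAt ℝ g 0) {f : ℝ → ℝ} :
    QuotientRelation g f ↔
      AnalyticAt ℝ f 0 ∧ ∀ᶠ u in 𝓝 (0 : ℝ), deriv (deriv X) u = f (u ^ 2 / 2) := by
  refine and_congr_right fun hf => ⟨fun hrel => ?_, fun hX => ?_⟩
  · have hX : Tendsto X (𝓝[≠] 0) (𝓝[≠] 0) := by
      refine tendsto_nhdsWithin_iff.mpr ⟨h.tendsto_inv.mono_left nhdsWithin_le_nhds, ?_⟩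
      rw [eventually_nhdsWithin_iff]
      filter_upwards [h.left_inv] with u hu hu0 hXu
      rw [mem_singleton_iff] at hXu
      exact hu0 (by rw [mem_singleton_iff, ← hu, hXu, h.map_zero])
    have hc : ContinuousAt (fun u : ℝ => f (u ^ 2 / 2)) 0 := by
      refine ContinuousAt.comp (g := f) ?_ (by fun_prop)
      simpa using hf.continuousAt
    refine (h.analyticAt_inv.deriv.deriv.continuousAt.eventuallyEq_nhds_iff_eventuallyEq_nhdsNE
      hc).mp ?_
    filter_upwards [hX.eventually hrel, hX.eventually (h.hasDerivAt_quotient hg),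
      h.left_inv.filter_mono nhdsWithin_le_nhds, h.energy_inv.filter_mono nhdsWithin_le_nhds]
      with u h1 h2 h3 h4
    rw [← h4, mul_div_cancel_left₀ _ two_ne_zero, h1.unique h2, h3]
  · filter_upwards [h.hasDerivAt_quotient hg, h.energy.filter_mono nhdsWithin_le_nhds,
      (h.tendsto.eventually hX).filter_mono nhdsWithin_le_nhds] with x h1 h2 h3
    rwa [h3, ← h2, mul_div_cancel_left₀ _ two_ne_zero] at h1

/-- `X'' u` is an analytic function of `u ^ 2 / 2` iff `X''` is even, that is, iff the even part of
`X'` is constant; this constant is `X' 0 = 1`. -/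
theorem exists_quotientRelation_iff (h : IsEnergyChart g X U) (hg : AnalyticAt ℝ g 0) :
    (∃ f, QuotientRelation g f) ↔ ∀ᶠ u in 𝓝 (0 : ℝ), deriv X u + deriv X (-u) = 2 := by
  simp only [h.quotientRelation_iff hg]
  have hneg : Tendsto (fun u : ℝ => -u) (𝓝 0) (𝓝 0) := continuous_neg.tendsto' 0 0 (by simp)
  have hderiv : ∀ᶠ u in 𝓝 (0 : ℝ), HasDerivAt (fun v => deriv X v + deriv X (-v))
      (deriv (deriv X) u - deriv (deriv X) (-u)) u := by
    filter_upwards [h.analyticAt_inv.deriv.eventually_analyticAt,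
      hneg.eventually h.analyticAt_inv.deriv.eventually_analyticAt] with u h1 h2
    have h3 := h1.differentiableAt.hasDerivAt.fun_add
      (h2.differentiableAt.hasDerivAt.comp u (hasDerivAt_neg u))
    simpa [sub_eq_add_neg, Function.comp_def] using h3
  constructor
  · rintro ⟨f, -, hX⟩
    have h0 : ∀ᶠ u in 𝓝 (0 : ℝ), HasDerivAt (fun v => deriv X v + deriv X (-v)) 0 u := by
      filter_upwards [hderiv, hX, hneg.eventually hX] with u h1 h2 h3
      rwa [h2, h3, neg_sq, sub_self] at h1
    obtain ⟨ε, hε, hball⟩ := Metric.eventually_nhds_iff_ball.mp h0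
    filter_upwards [Metric.ball_mem_nhds 0 hε] with u hu
    have h1 := Metric.isOpen_ball.is_const_of_deriv_eq_zero
      (convex_ball (0 : ℝ) ε).isPreconnected
      (fun v hv => (hball v hv).differentiableAt.differentiableWithinAt)
      (fun v hv => (hball v hv).deriv) hu (Metric.mem_ball_self hε)
    rw [h1, neg_zero, h.deriv_inv_zero]
    norm_num
  · intro hodd
    have heven : ∀ᶠ u in 𝓝 (0 : ℝ), deriv (deriv X) (-u) = deriv (deriv X) u := by
      filter_upwards [hderiv, hodd.eventually_nhds] with u h1 h2
      have h3 := ((hasDerivAt_const u (2 : ℝ)).congr_of_eventuallyEq h2).unique h1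
      linarith
    obtain ⟨φ, hφ, hXφ⟩ := h.analyticAt_inv.deriv.deriv.exists_analyticAt_comp_sq heven
    refine ⟨fun s => φ (2 * s), ?_, ?_⟩
    · exact AnalyticAt.comp (g := φ) (by simpa using hφ) (analyticAt_const.mul analyticAt_id)
    · filter_upwards [hXφ] with u hu
      rw [hu, mul_div_cancel₀ _ two_ne_zero]

end IsEnergyChart

/-! ### Solutions of the planar system -/

/-- The phase equation `θ' = 1 / w θ` with a positive `L`-periodic `w` has a global increasing
solution, which advances by `L` in the time `∫₀ᴸ w`. -/
theorem exists_phase {w : ℝ → ℝ} {L : ℝ} (hw : Continuous w) (hper : Function.Periodic w L)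
    (hpos : ∀ θ, 0 < w θ) (hL : 0 < L) (θ₀ : ℝ) :
    ∃ Θ : ℝ → ℝ, StrictMono Θ ∧ Θ 0 = θ₀ ∧ (∀ t, HasDerivAt Θ (w (Θ t))⁻¹ t) ∧
      ∀ t, Θ (t + ∫ s in (0 : ℝ)..L, w s) = Θ t + L := by
  set τ : ℝ → ℝ := fun θ => ∫ s in (0 : ℝ)..θ, w s with hτ
  have hint : ∀ a b, IntervalIntegrable w MeasureTheory.volume a b := fun a b =>
    hw.intervalIntegrable a b
  have hd : ∀ θ, HasDerivAt τ (w θ) θ := fun θ =>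
    intervalIntegral.integral_hasDerivAt_right (hint 0 θ)
      (hw.stronglyMeasurableAtFilter _ _) hw.continuousAt
  have hmono : StrictMono τ := strictMono_of_hasDerivAt_pos hd hpos
  have hcont : Continuous τ := continuous_iff_continuousAt.mpr fun θ => (hd θ).continuousAt
  have hsurj : Function.Surjective τ := hcont.surjective
    (hper.tendsto_atTop_intervalIntegral_of_pos' (hint 0 L) hpos hL)
    (hper.tendsto_atBot_intervalIntegral_of_pos' (hint 0 L) hpos hL)
  let e : ℝ ≃o ℝ := hmono.orderIsoOfSurjective τ hsurj
  have he : ∀ t, τ (e.symm t) = t := fun t => e.apply_symm_apply t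
  have hτL : ∀ θ, τ (θ + L) = τ θ + ∫ s in (0 : ℝ)..L, w s := fun θ => by
    have h1 := intervalIntegral.integral_add_adjacent_intervals (hint 0 θ) (hint θ (θ + L))
    rw [hper.intervalIntegral_add_eq θ 0, zero_add] at h1
    exact h1.symm
  refine ⟨fun t => e.symm (t + τ θ₀), fun s t hst => e.symm.strictMono (by linarith), ?_, ?_, ?_⟩
  · simp only [zero_add]
    exact e.symm_apply_apply θ₀
  · intro t
    have h1 : HasDerivAt e.symm (w (e.symm (t + τ θ₀)))⁻¹ (t + τ θ₀) :=
      HasDerivAt.of_local_left_inverse e.symm.continuous.continuousAt (hd _) (hpos _).ne'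
        (Eventually.of_forall he)
    exact h1.comp_add_const t (τ θ₀)
  · intro t
    apply hmono.injective
    rw [hτL, he, he]
    ring

/-- Uniqueness of solutions; only one of the two is assumed to stay where `g` is analytic, as local
uniqueness makes the set of times of coincidence open. -/
theorem IsSolution.eq_of_analyticAt {g : ℝ → ℝ} {γ δ : ℝ → ℝ × ℝ} (hγ : IsSolution g γ)
    (hδ : IsSolution g δ) (h0 : γ 0 = δ 0) (hg : ∀ t, AnalyticAt ℝ g (γ t).1) : γ = δ := by
  have hder : ∀ {η : ℝ → ℝ × ℝ}, IsSolution g η → ∀ t,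
      HasDerivAt η ((η t).2, -g (η t).1) t := fun hη t => (hη t).1.prodMk (hη t).2
  have hγc : Continuous γ := continuous_iff_continuousAt.mpr fun t => (hder hγ t).continuousAt
  have hδc : Continuous δ := continuous_iff_continuousAt.mpr fun t => (hder hδ t).continuousAt
  have hclopen : IsClopen {t | γ t = δ t} := by
    refine ⟨isClosed_eq hγc hδc, isOpen_iff_mem_nhds.mpr fun t ht => ?_⟩
    have hv : ContDiffAt ℝ 1 (fun p : ℝ × ℝ => (p.2, -g p.1)) (γ t) :=
      contDiffAt_snd.prodMk ((hg t).contDiffAt.comp (γ t) contDiffAt_fst).neg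
    obtain ⟨K, s, hs, hK⟩ := hv.exists_lipschitzOnWith
    refine ODE_solution_unique_of_eventually (v := fun _ p => (p.2, -g p.1)) (s := fun _ => s)
      (K := K) (Eventually.of_forall fun _ => hK) ?_ ?_ ht
    · filter_upwards [hγc.continuousAt.eventually_mem hs] with a ha
      exact ⟨hder hγ a, ha⟩
    · have ht' : γ t = δ t := ht
      rw [ht'] at hs
      filter_upwards [hδc.continuousAt.eventually_mem hs] with a ha
      exact ⟨hder hδ a, ha⟩
  have huniv := hclopen.eq_univ ⟨0, h0⟩
  funext t
  exact huniv.ge (mem_univ t)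

theorem HasMinimalPeriod.unique {γ : ℝ → ℝ × ℝ} {S T : ℝ} (hS : HasMinimalPeriod γ S)
    (hT : HasMinimalPeriod γ T) : S = T :=
  le_antisymm (hS.2.2 T hT.1 hT.2.1) (hT.2.2 S hS.1 hS.2.1)

/-- `u` lies in the region where the energy chart and `g` behave as at the origin. -/
structure IsRegularValue (g X U : ℝ → ℝ) (u : ℝ) : Prop where
  analyticAt_inv : AnalyticAt ℝ X u
  deriv_pos : 0 < deriv X u
  left_inv : U (X u) = u
  analyticAt_force : AnalyticAt ℝ g (X u)
  map_mul_deriv : g (X u) * deriv X u = u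

theorem IsEnergyChart.eventually_isRegularValue {g X U : ℝ → ℝ} (h : IsEnergyChart g X U)
    (hg : AnalyticAt ℝ g 0) : ∀ᶠ u in 𝓝 (0 : ℝ), IsRegularValue g X U u := by
  have hpos : 0 < deriv X 0 := by rw [h.deriv_inv_zero]; exact one_pos
  filter_upwards [h.analyticAt_inv.eventually_analyticAt,
    h.analyticAt_inv.deriv.continuousAt.eventually (lt_mem_nhds hpos), h.left_inv,
    h.tendsto_inv.eventually hg.eventually_analyticAt, h.map_mul_deriv_inv hg] with u h1 h2 h3 h4 h5
  exact ⟨h1, h2, h3, h4, h5⟩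

/-- The time the orbit `u = r sin θ`, `y = r cos θ` takes for one turn. -/
noncomputable def turnTime (X : ℝ → ℝ) (r : ℝ) : ℝ :=
  ∫ s in (0 : ℝ)..2 * Real.pi, deriv X (r * Real.sin s)

theorem mul_sin_mem_ball {r ε : ℝ} (hr : 0 < r) (hrε : r < ε) (s : ℝ) :
    r * Real.sin s ∈ Metric.ball (0 : ℝ) ε := by
  rw [mem_ball_zero_iff, Real.norm_eq_abs, abs_mul, abs_of_pos hr]
  exact (mul_le_of_le_one_right hr.le (Real.abs_sin_le_one s)).trans_lt hrε

/-- In polar coordinates `u = r sin θ`, `y = r cos θ` of the energy chart the system reads `r' = 0`,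
`θ' = 1 / X' (r sin θ)`. -/
theorem exists_periodic_orbit {g X U : ℝ → ℝ} {ε r : ℝ}
    (h : ∀ u ∈ Metric.ball (0 : ℝ) ε, IsRegularValue g X U u) (hr : 0 < r) (hrε : r < ε)
    (θ₀ : ℝ) :
    ∃ γ, IsSolution g γ ∧ γ 0 = (X (r * Real.sin θ₀), r * Real.cos θ₀) ∧
      (∀ t, AnalyticAt ℝ g (γ t).1) ∧ HasMinimalPeriod γ (turnTime X r) := by
  have hreg : ∀ s, IsRegularValue g X U (r * Real.sin s) := fun s =>
    h _ (mul_sin_mem_ball hr hrε s)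
  have hw : Continuous fun s => deriv X (r * Real.sin s) :=
    continuous_iff_continuousAt.mpr fun s =>
      ContinuousAt.comp (g := deriv X) (hreg s).analyticAt_inv.deriv.continuousAt (by fun_prop)
  have hper : Function.Periodic (fun s => deriv X (r * Real.sin s)) (2 * Real.pi) := fun s => by
    simp only [Real.sin_add_two_pi]
  obtain ⟨Θ, hmono, hΘ0, hΘ, hΘL⟩ := exists_phase hw hper (fun s => (hreg s).deriv_pos)
    Real.two_pi_pos θ₀
  have hT : 0 < turnTime X r := intervalIntegral.intervalIntegral_pos_of_pos
    (hw.intervalIntegrable _ _) (fun s => (hreg s).deriv_pos) Real.two_pi_pos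
  refine ⟨fun t => (X (r * Real.sin (Θ t)), r * Real.cos (Θ t)), fun t => ⟨?_, ?_⟩, ?_,
    fun t => (hreg _).analyticAt_force, hT, fun t => ?_, fun S hS hSper => ?_⟩
  · have h1 := (hreg (Θ t)).analyticAt_inv.differentiableAt.hasDerivAt.comp t
      ((hΘ t).sin.const_mul r)
    refine h1.congr_deriv ?_
    have := (hreg (Θ t)).deriv_pos.ne'
    field_simp
  · refine ((hΘ t).cos.const_mul r).congr_deriv ?_
    have h1 := (hreg (Θ t)).deriv_pos.ne'
    have h2 := (hreg (Θ t)).map_mul_deriv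
    field_simp
    linear_combination h2
  · simp only [hΘ0]
  · change (X (r * Real.sin (Θ (t + turnTime X r))), r * Real.cos (Θ (t + turnTime X r))) = _
    rw [turnTime, hΘL, Real.sin_add_two_pi, Real.cos_add_two_pi]
  · -- A period `S` turns the phase by a positive multiple of `2 π`.
    have h1 := hSper 0
    simp only [zero_add, Prod.mk.injEq] at h1
    have hsin : Real.sin (Θ S) = Real.sin (Θ 0) := by
      have h2 := congrArg U h1.1
      rw [(hreg _).left_inv, (hreg _).left_inv] at h2
      exact mul_left_cancel₀ hr.ne' h2
    have hcos : Real.cos (Θ S) = Real.cos (Θ 0) := mul_left_cancel₀ hr.ne' h1.2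
    obtain ⟨k, hk⟩ := Real.Angle.angle_eq_iff_two_pi_dvd_sub.mp
      (Real.Angle.cos_sin_inj hcos hsin)
    have hlt : 0 < Θ S - Θ 0 := sub_pos.mpr (hmono hS)
    have hk1 : (1 : ℝ) ≤ k := by
      rw [hk] at hlt
      exact_mod_cast pos_of_mul_pos_right hlt Real.two_pi_pos.le
    have hle : Θ (0 + turnTime X r) ≤ Θ S := by
      rw [turnTime, hΘL]
      have := le_mul_of_one_le_right Real.two_pi_pos.le hk1
      linarith
    simpa using hmono.le_iff_le.mp hle

/-- Every point near the origin other than the origin itself lies on one of the curves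
`u = r sin θ`, `y = r cos θ`. -/
theorem IsEnergyChart.eventually_exists_polar {g X U : ℝ → ℝ} (h : IsEnergyChart g X U) {ε : ℝ}
    (hε : 0 < ε) : ∀ᶠ p in 𝓝[≠] (0 : ℝ × ℝ), ∃ r θ : ℝ, 0 < r ∧ r < ε ∧
      (X (r * Real.sin θ), r * Real.cos θ) = p := by
  have hc : Tendsto (fun p : ℝ × ℝ => ‖(⟨p.2, U p.1⟩ : ℂ)‖) (𝓝 0) (𝓝 0) := by
    have h1 : ContinuousAt (fun p : ℝ × ℝ => Complex.mk p.2 (U p.1)) 0 := by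
      have h2 : ContinuousAt (fun p : ℝ × ℝ => U p.1) 0 :=
        ContinuousAt.comp (g := U) h.analyticAt.continuousAt continuousAt_fst
      simp only [Complex.mk_eq_add_mul_I]
      exact (Complex.continuous_ofReal.continuousAt.comp continuousAt_snd).add
        ((Complex.continuous_ofReal.continuousAt.comp h2).mul continuousAt_const)
    have h3 := h1.norm.tendsto
    simpa [h.map_zero, Complex.mk_eq_add_mul_I] using h3
  rw [eventually_nhdsWithin_iff]
  have hfst : Tendsto (fun p : ℝ × ℝ => p.1) (𝓝 0) (𝓝 0) := continuous_fst.tendsto' _ _ rfl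
  filter_upwards [hc.eventually (gt_mem_nhds hε), hfst.eventually h.right_inv] with p hp hX hp0
  set z : ℂ := ⟨p.2, U p.1⟩ with hz
  have hz0 : z ≠ 0 := by
    intro hz0
    have h1 : p.2 = 0 := congrArg Complex.re hz0
    have h2 : U p.1 = 0 := congrArg Complex.im hz0
    exact hp0 (Prod.ext (by rw [← hX, h2, h.inv_zero]; rfl) h1)
  refine ⟨‖z‖, z.arg, norm_pos_iff.mpr hz0, hp, Prod.ext ?_ ?_⟩
  · simp only [Complex.norm_mul_sin_arg, hz, hX]
  · simp only [Complex.norm_mul_cos_arg, hz]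

/-! ### Averages over circles and the period function -/

theorem IsPreconnected.forall_pos_or_forall_neg {f : ℝ → ℝ} {s : Set ℝ} (hs : IsPreconnected s)
    (hf : ContinuousOn f s) (hne : ∀ x ∈ s, f x ≠ 0) : (∀ x ∈ s, 0 < f x) ∨ ∀ x ∈ s, f x < 0 := by
  by_contra! hcon
  obtain ⟨⟨x, hx, hfx⟩, y, hy, hfy⟩ := hcon
  obtain ⟨z, hz, hfz⟩ := hs.intermediate_value hx hy hf ⟨hfx, hfy⟩
  exact hne z hz hfz

theorem continuous_comp_mul_sin {e : ℝ → ℝ} {ε r : ℝ}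
    (he : ∀ u ∈ Metric.ball (0 : ℝ) ε, AnalyticAt ℝ e u) (hr : 0 < r) (hrε : r < ε) :
    Continuous fun s => e (r * Real.sin s) :=
  continuous_iff_continuousAt.mpr fun s =>
    ContinuousAt.comp (g := e) (he _ (mul_sin_mem_ball hr hrε s)).continuousAt (by fun_prop)

theorem ContinuousAt.tendsto_integral_comp_mul_sin {e : ℝ → ℝ} (he : ContinuousAt e 0) :
    Tendsto (fun r => ∫ s in (0 : ℝ)..2 * Real.pi, (e (r * Real.sin s) - e 0)) (𝓝[>] 0) (𝓝 0) := by
  rw [Metric.tendsto_nhds]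
  intro δ hδ
  have hδ' : 0 < δ / (4 * Real.pi) := by positivity
  obtain ⟨ε, hε, hball⟩ := Metric.eventually_nhds_iff_ball.mp (Metric.tendsto_nhds.mp he _ hδ')
  filter_upwards [Ioo_mem_nhdsGT hε] with r hr
  rw [dist_zero_right]
  have h1 := intervalIntegral.norm_integral_le_of_norm_le_const (a := 0) (b := 2 * Real.pi)
    (f := fun s => e (r * Real.sin s) - e 0) (C := δ / (4 * Real.pi)) fun s _ =>
      (hball _ (mul_sin_mem_ball hr.1 hr.2 s)).le
  refine h1.trans_lt ?_
  rw [sub_zero, abs_of_pos Real.two_pi_pos]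
  field_simp
  linarith

theorem integral_comp_mul_sin_pos {d : ℝ → ℝ} {ε r : ℝ} (hr : 0 < r) (hrε : r < ε)
    (hd : Continuous fun s => d (r * Real.sin s))
    (hnonneg : ∀ u ∈ Metric.ball (0 : ℝ) ε, 0 ≤ d u) (hpos : 0 < d r) :
    0 < ∫ s in (0 : ℝ)..2 * Real.pi, d (r * Real.sin s) :=
  intervalIntegral.integral_pos Real.two_pi_pos hd.continuousOn
    (fun s _ => hnonneg _ (mul_sin_mem_ball hr hrε s))
    ⟨Real.pi / 2, ⟨by positivity, by linarith [Real.pi_pos]⟩, by simpa using hpos⟩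

/-- An even analytic function whose averages `∫₀²ᵖⁱ e (r sin s) ds` do not depend on `r` is
constant: otherwise `e - e 0` has a strict sign on a punctured neighbourhood of `0`. -/
theorem AnalyticAt.eventually_eq_of_even_of_integral_eq {e : ℝ → ℝ} (he : AnalyticAt ℝ e 0)
    (heven : ∀ᶠ u in 𝓝 (0 : ℝ), e (-u) = e u) {K : ℝ}
    (hK : ∀ᶠ r in 𝓝[>] (0 : ℝ), ∫ s in (0 : ℝ)..2 * Real.pi, e (r * Real.sin s) = K) :
    ∀ᶠ u in 𝓝 (0 : ℝ), e u = e 0 := by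
  obtain ⟨ε₀, hε₀, hball₀⟩ := Metric.eventually_nhds_iff_ball.mp he.eventually_analyticAt
  have hsub : ∀ᶠ r in 𝓝[>] (0 : ℝ), ∫ s in (0 : ℝ)..2 * Real.pi, (e (r * Real.sin s) - e 0) =
      K - 2 * Real.pi * e 0 := by
    filter_upwards [hK, Ioo_mem_nhdsGT hε₀] with r h1 h2
    rw [intervalIntegral.integral_sub
      ((continuous_comp_mul_sin hball₀ h2.1 h2.2).intervalIntegrable _ _)
      intervalIntegrable_const, h1, intervalIntegral.integral_const, sub_zero, smul_eq_mul]
  have hK0 : K - 2 * Real.pi * e 0 = 0 :=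
    tendsto_nhds_unique (tendsto_const_nhds.congr' (hsub.mono fun _ h => h.symm))
      he.continuousAt.tendsto_integral_comp_mul_sin
  rw [hK0] at hsub
  rcases he.eventually_eq_or_eventually_ne (analyticAt_const (v := e 0)) with h | hne
  · exact h
  exfalso
  rw [eventually_nhdsWithin_iff] at hne
  obtain ⟨ε, hε, hball⟩ := Metric.eventually_nhds_iff_ball.mp
    (hne.and (heven.and he.eventually_analyticAt))
  have hIoo : ∀ {u}, u ∈ Ioo 0 ε → u ∈ Metric.ball (0 : ℝ) ε := fun hu => by
    rw [mem_ball_zero_iff, Real.norm_eq_abs, abs_of_pos hu.1]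
    exact hu.2
  have hcont : ContinuousOn (fun u => e u - e 0) (Ioo 0 ε) := fun u hu =>
    ((hball u (hIoo hu)).2.2.continuousAt.sub continuousAt_const).continuousWithinAt
  have hne' : ∀ u ∈ Ioo 0 ε, e u - e 0 ≠ 0 := fun u hu =>
    sub_ne_zero.mpr ((hball u (hIoo hu)).1 hu.1.ne')
  have habs : ∀ u ∈ Metric.ball (0 : ℝ) ε, e u = e |u| := fun u hu => by
    rcases abs_choice u with h | h
    · rw [h]
    · rw [h, (hball u hu).2.1]
  have hmem : ∀ u ∈ Metric.ball (0 : ℝ) ε, u ≠ 0 → |u| ∈ Ioo 0 ε := fun u hu hu0 =>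
    ⟨abs_pos.mpr hu0, by simpa using hu⟩
  obtain ⟨r, hr, hr'⟩ := (hsub.and (Ioo_mem_nhdsGT hε)).exists
  have hcr := continuous_comp_mul_sin (fun u hu => (hball u hu).2.2) hr'.1 hr'.2
  rcases isPreconnected_Ioo.forall_pos_or_forall_neg hcont hne' with hsign | hsign
  · refine (integral_comp_mul_sin_pos (d := fun u => e u - e 0) hr'.1 hr'.2
      (hcr.sub continuous_const) (fun u hu => ?_) (hsign r hr')).ne' hr
    rcases eq_or_ne u 0 with rfl | hu0
    · simp
    · have := hsign _ (hmem u hu hu0)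
      rw [← habs u hu] at this
      exact this.le
  · have h1 := integral_comp_mul_sin_pos (d := fun u => e 0 - e u) hr'.1 hr'.2
      (continuous_const.sub hcr) (fun u hu => ?_) (by linarith [hsign r hr'])
    · have h2 := intervalIntegral.integral_neg (μ := MeasureTheory.volume) (a := 0)
        (b := 2 * Real.pi) (f := fun s => e (r * Real.sin s) - e 0)
      simp only [neg_sub, hr, neg_zero] at h2
      exact h1.ne' h2
    · rcases eq_or_ne u 0 with rfl | hu0
      · simp
      · have := hsign _ (hmem u hu hu0)
        rw [← habs u hu] at this
        linarith

/-- The substitution `s ↦ s + π` reverses the sign of `sin s`. -/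
theorem integral_comp_neg_mul_sin (e : ℝ → ℝ) (r : ℝ) :
    ∫ s in (0 : ℝ)..2 * Real.pi, e (-(r * Real.sin s)) =
      ∫ s in (0 : ℝ)..2 * Real.pi, e (r * Real.sin s) := by
  have hper : Function.Periodic (fun s => e (r * Real.sin s)) (2 * Real.pi) := fun s => by
    simp only [Real.sin_add_two_pi]
  have h1 := intervalIntegral.integral_comp_add_right (a := 0) (b := 2 * Real.pi)
    (fun s => e (r * Real.sin s)) Real.pi
  simp only [Real.sin_add_pi, mul_neg] at h1
  rw [h1, zero_add, add_comm, hper.intervalIntegral_add_eq Real.pi 0, zero_add]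

/-- Only the even part of `X'` contributes to the period. -/
theorem integral_deriv_add_deriv_neg {X : ℝ → ℝ} {ε r : ℝ}
    (hX : ∀ u ∈ Metric.ball (0 : ℝ) ε, AnalyticAt ℝ X u) (hr : 0 < r) (hrε : r < ε) :
    ∫ s in (0 : ℝ)..2 * Real.pi, (deriv X (r * Real.sin s) + deriv X (-(r * Real.sin s))) =
      2 * turnTime X r := by
  have h1 := continuous_comp_mul_sin (fun u hu => (hX u hu).deriv) hr hrε
  have h2 := continuous_comp_mul_sin (e := fun u => deriv X (-u))
    (fun u hu => (hX (-u) (by simpa using hu)).deriv.fun_comp analyticAt_id.neg) hr hrε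
  rw [intervalIntegral.integral_add (h1.intervalIntegrable _ _) (h2.intervalIntegrable _ _),
    integral_comp_neg_mul_sin, ← turnTime, ← two_mul]

theorem IsEnergyChart.turnTime_eventually_const_iff {g X U : ℝ → ℝ} (h : IsEnergyChart g X U) :
    (∃ T, ∀ᶠ r in 𝓝[>] (0 : ℝ), turnTime X r = T) ↔
      ∀ᶠ u in 𝓝 (0 : ℝ), deriv X u + deriv X (-u) = 2 := by
  obtain ⟨ε, hε, hball⟩ := Metric.eventually_nhds_iff_ball.mp
    h.analyticAt_inv.eventually_analyticAt
  constructor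
  · rintro ⟨T, hT⟩
    have he : AnalyticAt ℝ (fun u => deriv X u + deriv X (-u)) 0 :=
      h.analyticAt_inv.deriv.add
        (AnalyticAt.fun_comp (g := deriv X) (by simpa using h.analyticAt_inv.deriv)
          analyticAt_id.neg)
    have h1 := he.eventually_eq_of_even_of_integral_eq (K := 2 * T)
      (Eventually.of_forall fun u => by rw [neg_neg, add_comm]) (by
        filter_upwards [hT, Ioo_mem_nhdsGT hε] with r h2 h3
        rw [integral_deriv_add_deriv_neg hball h3.1 h3.2, h2])
    filter_upwards [h1] with u hu
    rw [hu, neg_zero, h.deriv_inv_zero]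
    norm_num
  · intro hodd
    obtain ⟨ε', hε', hball'⟩ := Metric.eventually_nhds_iff_ball.mp hodd
    refine ⟨2 * Real.pi, ?_⟩
    filter_upwards [Ioo_mem_nhdsGT hε, Ioo_mem_nhdsGT hε'] with r h1 h2
    have h3 := integral_deriv_add_deriv_neg hball h1.1 h1.2
    rw [intervalIntegral.integral_congr (g := fun _ => (2 : ℝ)) fun s _ =>
      hball' _ (mul_sin_mem_ball h2.1 h2.2 s), intervalIntegral.integral_const, sub_zero,
      smul_eq_mul] at h3
    linarith

theorem IsEnergyChart.eventually_hasMinimalPeriod {g X U : ℝ → ℝ} (h : IsEnergyChart g X U)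
    (hg : AnalyticAt ℝ g 0) {η : ℝ} (hη : 0 < η) :
    ∀ᶠ p in 𝓝[≠] (0 : ℝ × ℝ), ∃ r, 0 < r ∧ r < η ∧ (∃ γ, IsSolution g γ ∧ γ 0 = p) ∧
      ∀ γ, IsSolution g γ → γ 0 = p → HasMinimalPeriod γ (turnTime X r) := by
  obtain ⟨ε, hε, hball⟩ := Metric.eventually_nhds_iff_ball.mp (h.eventually_isRegularValue hg)
  filter_upwards [h.eventually_exists_polar (lt_min hε hη)] with p hp
  obtain ⟨r, θ, hr, hrε, rfl⟩ := hp
  obtain ⟨γ, h1, h2, h3, h4⟩ := exists_periodic_orbit hball hr (hrε.trans_le (min_le_left _ _)) θ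
  refine ⟨r, hr, hrε.trans_le (min_le_right _ _), ⟨γ, h1, h2⟩, fun δ hδ hδ0 => ?_⟩
  rwa [← h1.eq_of_analyticAt hδ (h2.trans hδ0.symm) h3]

theorem IsEnergyChart.hasCenter {g X U : ℝ → ℝ} (h : IsEnergyChart g X U)
    (hg : AnalyticAt ℝ g 0) (hg0 : g 0 = 0) : HasCenter g := by
  refine ⟨hg0, ?_⟩
  filter_upwards [h.eventually_hasMinimalPeriod hg one_pos] with p hp
  obtain ⟨r, -, -, hex, hper⟩ := hp
  exact ⟨hex, fun γ h1 h2 => ⟨_, hper γ h1 h2⟩⟩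

theorem IsEnergyChart.hasIsochronousCenter_iff {g X U : ℝ → ℝ} (h : IsEnergyChart g X U)
    (hg : AnalyticAt ℝ g 0) (hg0 : g 0 = 0) :
    HasIsochronousCenter g ↔ ∃ T, ∀ᶠ r in 𝓝[>] (0 : ℝ), turnTime X r = T := by
  constructor
  · rintro ⟨-, T, hT⟩
    refine ⟨T, ?_⟩
    obtain ⟨ε, hε, hball⟩ := Metric.eventually_nhds_iff_ball.mp (h.eventually_isRegularValue hg)
    -- Follow the orbits through the points `(0, r)`.
    have hline : Tendsto (fun r : ℝ => ((0 : ℝ), r)) (𝓝[>] 0) (𝓝[≠] (0 : ℝ × ℝ)) := by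
      refine tendsto_nhdsWithin_iff.mpr ⟨?_, ?_⟩
      · exact ((Continuous.prodMk_right (0 : ℝ)).tendsto' 0 0 rfl).mono_left nhdsWithin_le_nhds
      · filter_upwards [self_mem_nhdsWithin] with r hr hr0
        exact (ne_of_gt (mem_Ioi.mp hr)) (congrArg Prod.snd hr0)
    filter_upwards [hline.eventually hT, Ioo_mem_nhdsGT hε] with r h1 h2
    obtain ⟨γ, h3, h4, -, h5⟩ := exists_periodic_orbit hball h2.1 h2.2 0
    rw [Real.sin_zero, Real.cos_zero, mul_zero, mul_one, h.inv_zero] at h4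
    exact h5.unique (h1 γ h3 h4)
  · rintro ⟨T, hT⟩
    obtain ⟨η, hη, hηT⟩ := (mem_nhdsGT_iff_exists_Ioo_subset).mp hT
    refine ⟨h.hasCenter hg hg0, T, ?_⟩
    filter_upwards [h.eventually_hasMinimalPeriod hg hη] with p hp γ h1 h2
    obtain ⟨r, hr, hrη, -, hper⟩ := hp
    have hrT : turnTime X r = T := hηT ⟨hr, hrη⟩
    exact hrT ▸ hper γ h1 h2

/-! ### The characterization of isochronous centers -/

theorem StandingHypothesis.analyticAt_zero {g : ℝ → ℝ} {a b c : ℝ}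
    (hg : StandingHypothesis g a b c) : AnalyticAt ℝ g 0 :=
  hg.analytic 0 ⟨hg.left_neg.le, hg.right_pos.le⟩

theorem theoremB (g : ℝ → ℝ) (a b c : ℝ) (hg : StandingHypothesis g a b c) :
    (HasIsochronousCenter g ↔ ∃ f : ℝ → ℝ, QuotientRelation g f) ∧
    (∀ f : ℝ → ℝ, QuotientRelation g f →
      f 0 = -iteratedDeriv 2 g 0 / 3 ∧
      deriv f 0 = 7 / 9 * iteratedDeriv 2 g 0 ^ 3 - iteratedDeriv 4 g 0 / 5 ∧
      iteratedDeriv 2 f 0 = -(1 / 21) * iteratedDeriv 6 g 0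
        - 310 / 54 * iteratedDeriv 2 g 0 ^ 5
        + 2 * iteratedDeriv 2 g 0 ^ 2 * iteratedDeriv 4 g 0 ∧
      ∀ (g₁ : ℝ → ℝ) (a₁ b₁ c₁ : ℝ), StandingHypothesis g₁ a₁ b₁ c₁ →
        ∀ f₁ : ℝ → ℝ, QuotientRelation g₁ f₁ →
          ∀ n : ℕ, (∀ k ≤ 2 * n + 2, iteratedDeriv k g 0 = iteratedDeriv k g₁ 0) →
            iteratedDeriv n f 0 = iteratedDeriv n f₁ 0) := by
  have hga := hg.analyticAt_zero
  obtain ⟨X, U, h⟩ := exists_isEnergyChart hga hg.map_zero hg.deriv_zero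
  refine ⟨?_, fun f hf => ?_⟩
  · rw [h.hasIsochronousCenter_iff hga hg.map_zero, h.turnTime_eventually_const_iff,
      h.exists_quotientRelation_iff hga]
  · obtain ⟨h0, h1, h2⟩ := hf.initial_derivatives hga hg.map_zero hg.deriv_zero
    exact ⟨h0, h1, h2, fun g₁ a₁ b₁ c₁ hg₁ f₁ hf₁ n hjet =>
      hf.iteratedDeriv_eq hga hg.map_zero hg.deriv_zero hg₁.analyticAt_zero hg₁.map_zero
        hg₁.deriv_zero hf₁ hjet⟩
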